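/- Fix constants $0<C_1\le C_2$, $\delta>0$, $C>0$ and an integer $K\ge 1$. A finite simple graph $G=(V,E)$ with $n=|V|$ vertices is called *proper* (for these constants) if: - (P1) $G$ is connected; - (P2) calling a cycle short if its length is at most $\frac{\ln n}{10\ln\ln n}$, any two distinct short cycles are at distance at least $\frac{\ln n}{\ln\ln n}$ in $G$; - (P3) $G$ contains a cycle of length $3$, a cycle of length $5$ and a cycle of length $7$; - (P4) for all symmetric edge weights $c$ with $C_1\le c_{ij}\le C_2$ for each $(i,j)\in E$, every $L\subset V$ with $|L|\le K$ and every $S\subset V\setminus L$ with $|S|\le n/2$, $$\sum_{(i,j)\in E_{G'}(S,\bar S)}c_{ij}\ \ge\ \frac{C_1}{6C_2}\sum_{i\in S}c_i',$$ where $G'=(V\setminus L,E')$ is the subgraph induced by $V\setminus L$, $E_{G'}(S,\bar S)$ is the set of edges of $G'$ with one end in $S$ and the other in $\bar S=V\setminus(L\cup S)$, and $c_i'=\sum_{j:(i,j)\in E'}c_{ij}$; - (P5) $\delta C\ln n<d(i)<4C\ln n$ for the degree $d(i)$ of every vertex $i\in V$. **Theorem.** There is a constant $M>0$, depending only on $C_1,C_2,K,\delta,C$,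 such that the following holds. Let $G=(V,E)$ be a proper graph with $n$ vertices and let $c$ be symmetric conductances on its edges with $C_1\le c_{ij}\le C_2$ for all $(i,j)\in E$; put $c_i=\sum_{j:(i,j)\in E}c_{ij}$. Let $\Gamma=\{x_1,\dots,x_K\}\subset V$ be a set of $K$ distinct boundary vertices held at potentials $V_{x_k}=p_{x_k}\in[0,1]$, and let $(V_i)_{i\in V}$ be the resulting potential distribution, that is, $V_{x_k}=p_{x_k}$ for $1\le k\le K$ and $\sum_{j:(i,j)\in E}c_{ij}(V_i-V_j)=0$ for every $i\in V\setminus\Gamma$. Then for every $i\in V\setminus\Gamma$ $$\left|V_i-\frac{\sum_{k=1}^K p_{x_k}c_{x_k}}{\sum_{k=1}^K c_{x_k}}\right|\le\frac{M}{\ln n}.$$ -/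

import Mathlib

namespace ElectricalNetwork

variable {V : Type*}

/-- `c` assigns to every edge `(i, j)` of `G` a conductance `c i j = c j i` in `[C₁, C₂]`. The values
of `c` off the edges of `G` are never used. -/
structure IsConductance (G : SimpleGraph V) (C₁ C₂ : ℝ) (c : V → V → ℝ) : Prop where
  symm : ∀ i j, G.Adj i j → c i j = c j i
  lower : ∀ i j, G.Adj i j → C₁ ≤ c i j
  upper : ∀ i j, G.Adj i j → c i j ≤ C₂

/-- The total conductance `c_i = ∑_{(i,j) ∈ E} c_{ij}` at the vertex `i`. -/
noncomputable def vertexConductance [Fintype V] (G : SimpleGraph V) [DecidableRel G.Adj]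
    (c : V → V → ℝ) (i : V) : ℝ :=
  ∑ j with G.Adj i j, c i j

/-- For a vertex `i ∉ L`, the total conductance `c'_i` at `i` in the network induced on `V \ L`. -/
noncomputable def inducedConductance [Fintype V] [DecidableEq V] (G : SimpleGraph V)
    [DecidableRel G.Adj] (c : V → V → ℝ) (L : Finset V) (i : V) : ℝ :=
  ∑ j with G.Adj i j ∧ j ∉ L, c i j

/-- For `S ⊆ V \ L`, the total conductance of the edges of the graph induced on `V \ L` that have
one end in `S` and the other in `V \ (L ∪ S)`. Each such edge is counted once, from its end in
`S`. -/
noncomputable def cutConductance [Fintype V] [DecidableEq V] (G : SimpleGraph V)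
    [DecidableRel G.Adj] (c : V → V → ℝ) (L S : Finset V) : ℝ :=
  ∑ i ∈ S, ∑ j with G.Adj i j ∧ j ∉ L ∧ j ∉ S, c i j

/-- Proper graphs, for the constants `C₁ ≤ C₂`, `K`, `δ`, `C`. Here `n = Fintype.card V`. -/
structure IsProper [Fintype V] [DecidableEq V] (G : SimpleGraph V) [DecidableRel G.Adj]
    (C₁ C₂ : ℝ) (K : ℕ) (δ C : ℝ) : Prop where
  connected : G.Connected
  /-- Two different cycles (cycles with different edge sets) of length at most
  `ln n / (10 ln ln n)` have distance at least `ln n / ln ln n`. -/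
  short_cycles_far : ∀ (u w : V) (a : G.Walk u u) (b : G.Walk w w), a.IsCycle → b.IsCycle →
    (a.length : ℝ) ≤ Real.log (Fintype.card V) / (10 * Real.log (Real.log (Fintype.card V))) →
    (b.length : ℝ) ≤ Real.log (Fintype.card V) / (10 * Real.log (Real.log (Fintype.card V))) →
    {e | e ∈ a.edges} ≠ {e | e ∈ b.edges} →
    ∀ y ∈ a.support, ∀ z ∈ b.support,
      Real.log (Fintype.card V) / Real.log (Real.log (Fintype.card V)) ≤ (G.dist y z : ℝ)
  triangle : ∃ (u : V) (a : G.Walk u u), a.IsCycle ∧ a.length = 3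
  five_cycle : ∃ (u : V) (a : G.Walk u u), a.IsCycle ∧ a.length = 5
  seven_cycle : ∃ (u : V) (a : G.Walk u u), a.IsCycle ∧ a.length = 7
  /-- Expansion after the deletion of at most `K` vertices; the quotient inequality is multiplied
  out, so that nothing is asked where its denominator vanishes. -/
  expansion : ∀ c : V → V → ℝ, IsConductance G C₁ C₂ c →
    ∀ L S : Finset V, L.card ≤ K → Disjoint S L → (S.card : ℝ) ≤ (Fintype.card V : ℝ) / 2 →
      C₁ / (6 * C₂) * ∑ i ∈ S, inducedConductance G c L i ≤ cutConductance G c L S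
  degree_lower : ∀ i, δ * C * Real.log (Fintype.card V) < (G.degree i : ℝ)
  degree_upper : ∀ i, (G.degree i : ℝ) < 4 * C * Real.log (Fintype.card V)

/-- `v` is the potential distribution when the boundary vertices `x k` are held at the potentials
`p k`: by Ohm's law the current from `i` to `j` along an edge is `c i j * (v i - v j)`, and by
Kirchhoff's current law no current enters or leaves the network at a non-boundary vertex. -/
structure IsPotential [Fintype V] (G : SimpleGraph V) [DecidableRel G.Adj] (c : V → V → ℝ)
    {K : ℕ} (x : Fin K → V) (p : Fin K → ℝ) (v : V → ℝ) : Prop where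
  boundary : ∀ k, v (x k) = p k
  kirchhoff : ∀ i, i ∉ Set.range x → ∑ j with G.Adj i j, c i j * (v i - v j) = 0

end ElectricalNetwork

/-!
The potential is shown to vary by only `O(1 / ln n)` over the interior `V \ Γ`; conservation of the
total current through the boundary then forces its nearly constant value to be the mean of the
boundary values weighted by the conductances (`abs_sub_weighted_mean_le`).

For the oscillation, let `L'` be the Laplacian of the network induced on the interior. By Kirchhoff's
law `L' v` vanishes except at the neighbours of `Γ`, where it is bounded by `K * C₂`. Let `g` be
`ψ` on the neighbours of `Γ` and `0` elsewhere, with `ψ` of order `1 / ln n`. Since two short cycles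
cannot meet, two vertices have at most two common neighbours (`card_common_neighbors_le_two`), so a
vertex has at most `2K` neighbours next to `Γ`. Hence `L' g` dominates `|L' v|` up to an error `η`
of order `(ln n)⁻²` relative to the vertex conductance (`abs_laplacian_le_laplacian_barrier`), and
both `g + v` and `g - v` are almost superharmonic.

An almost superharmonic function `w` on an expander satisfies `w ≤ w i₀ + O(η ln n)` on more than
half of the vertices, for every `i₀`: the volume of the sublevel sets grows by a constant factor
whenever the level rises by a constant times `η` (`sublevel_volume_growth`,
`card_sublevel_gt_half`). Applied to `g + v` at `j` and to `g - v` at `i`, this gives two sets with a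
common vertex, at which the two bounds combine to `v i - v j ≤ 2ψ + O(η ln n) = O(1 / ln n)`
(`oscillation_le_of_barrier`, `oscillation_le`). No spectral theory is needed, and of the local
structure of the graph only its `4`-cycles matter.
-/

/-! ### Almost superharmonic functions on weighted expanders -/

section WeightedExpansion

variable {V : Type*} [Fintype V] [DecidableEq V]

/-- If the Laplacian of `w` is at least `-η` times the vertex weight, the total gradient flux out of
the sublevel set at `t` is at most `η` times its volume. Hence at most half of the boundary weight
guaranteed by expansion sits on edges along which `w` rises by more than `2η/κ`, and the other half
leads into the sublevel set at `t + 2η/κ`. -/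
lemma sublevel_volume_growth {a : V → V → ℝ} (hsymm : ∀ i j, a i j = a j i)
    (hnonneg : ∀ i j, 0 ≤ a i j) {U : Finset V} (hU : ∀ i j, j ∉ U → a i j = 0) {κ η : ℝ}
    (hκ : 0 < κ) (hη : 0 < η) {w : V → ℝ}
    (hw : ∀ i ∈ U, -η * ∑ j, a i j ≤ ∑ j, a i j * (w i - w j)) (t : ℝ)
    (hexp : κ * ∑ i ∈ U with w i ≤ t, ∑ j, a i j ≤
      ∑ i ∈ U with w i ≤ t, ∑ j ∈ (U.filter (w · ≤ t))ᶜ, a i j) :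
    (1 + κ / 2) * ∑ i ∈ U with w i ≤ t, ∑ j, a i j ≤
      ∑ i ∈ U with w i ≤ t + 2 * η / κ, ∑ j, a i j := by
  have hgap : 0 < 2 * η / κ := by positivity
  set S := U.filter (w · ≤ t) with hS
  set S' := U.filter (w · ≤ t + 2 * η / κ) with hS'
  have hSS' : S ⊆ S' := by
    intro i hi
    simp only [hS, hS', Finset.mem_filter] at hi ⊢
    exact ⟨hi.1, by linarith⟩
  -- The contributions of the edges inside `S` cancel in pairs.
  have hinner : ∑ i ∈ S, ∑ j ∈ S, a i j * (w i - w j) = 0 := by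
    have h : ∑ i ∈ S, ∑ j ∈ S, a i j * (w i - w j) = -∑ i ∈ S, ∑ j ∈ S, a i j * (w i - w j) := by
      conv_lhs => rw [Finset.sum_comm]
      rw [← Finset.sum_neg_distrib]
      refine Finset.sum_congr rfl fun i _ => ?_
      rw [← Finset.sum_neg_distrib]
      refine Finset.sum_congr rfl fun j _ => ?_
      rw [hsymm j i]; ring
    linarith
  have hflux : ∑ i ∈ S, ∑ j ∈ Sᶜ, a i j * (w j - w i) ≤ η * ∑ i ∈ S, ∑ j, a i j := by
    have h1 : ∑ i ∈ S, -η * ∑ j, a i j ≤ ∑ i ∈ S, ∑ j, a i j * (w i - w j) :=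
      Finset.sum_le_sum fun i hi => hw i (Finset.mem_filter.1 hi).1
    have h2 : ∑ i ∈ S, ∑ j, a i j * (w i - w j) = -∑ i ∈ S, ∑ j ∈ Sᶜ, a i j * (w j - w i) := by
      simp_rw [← Finset.sum_add_sum_compl S]
      rw [Finset.sum_add_distrib, hinner, zero_add, ← Finset.sum_neg_distrib]
      refine Finset.sum_congr rfl fun i _ => ?_
      rw [← Finset.sum_neg_distrib]
      exact Finset.sum_congr rfl fun j _ => by ring
    rw [← Finset.mul_sum] at h1
    linarith
  have hfar : (2 * η / κ) * ∑ i ∈ S, ∑ j ∈ S'ᶜ, a i j ≤ η * ∑ i ∈ S, ∑ j, a i j := by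
    refine le_trans ?_ hflux
    rw [Finset.mul_sum]
    refine Finset.sum_le_sum fun i hi => ?_
    rw [Finset.mul_sum]
    have hi' := (Finset.mem_filter.1 hi).2
    calc ∑ j ∈ S'ᶜ, 2 * η / κ * a i j ≤ ∑ j ∈ S'ᶜ, a i j * (w j - w i) := by
          refine Finset.sum_le_sum fun j hj => ?_
          by_cases hjU : j ∈ U
          · have : t + 2 * η / κ < w j := by
              by_contra h
              exact Finset.mem_compl.1 hj (Finset.mem_filter.2 ⟨hjU, not_lt.1 h⟩)
            rw [mul_comm]
            exact mul_le_mul_of_nonneg_left (by linarith) (hnonneg i j)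
          · simp [hU i j hjU]
      _ ≤ ∑ j ∈ Sᶜ, a i j * (w j - w i) := by
          refine Finset.sum_le_sum_of_subset_of_nonneg (Finset.compl_subset_compl.2 hSS') ?_
          intro j hj _
          by_cases hjU : j ∈ U
          · have : t < w j := by
              by_contra h
              exact Finset.mem_compl.1 hj (Finset.mem_filter.2 ⟨hjU, not_lt.1 h⟩)
            exact mul_nonneg (hnonneg i j) (by linarith)
          · simp [hU i j hjU]
  have hsplit : ∑ i ∈ S, ∑ j ∈ Sᶜ, a i j =
      ∑ i ∈ S, ∑ j ∈ S' \ S, a i j + ∑ i ∈ S, ∑ j ∈ S'ᶜ, a i j := by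
    rw [← Finset.sum_add_distrib]
    refine Finset.sum_congr rfl fun i _ => ?_
    rw [← Finset.sum_union]
    · congr 1
      ext j
      have := @hSS' j
      simp only [Finset.mem_compl, Finset.mem_union, Finset.mem_sdiff]
      tauto
    · rw [Finset.disjoint_left]
      intro j hj
      simp [(Finset.mem_sdiff.1 hj).1]
  have hnew : ∑ i ∈ S, ∑ j ∈ S' \ S, a i j ≤ ∑ i ∈ S' \ S, ∑ j, a i j := by
    rw [Finset.sum_comm]
    refine Finset.sum_le_sum fun j _ => ?_
    simp_rw [fun i => hsymm i j]
    exact Finset.sum_le_sum_of_subset_of_nonneg (Finset.subset_univ _) fun i _ _ => hnonneg j i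
  have hvol : ∑ i ∈ S' \ S, ∑ j, a i j + ∑ i ∈ S, ∑ j, a i j = ∑ i ∈ S', ∑ j, a i j :=
    Finset.sum_sdiff hSS'
  have hfar' : ∑ i ∈ S, ∑ j ∈ S'ᶜ, a i j ≤ κ / 2 * ∑ i ∈ S, ∑ j, a i j := by
    have h := mul_le_mul_of_nonneg_left hfar (by positivity : 0 ≤ κ / (2 * η))
    have e1 : κ / (2 * η) * (2 * η / κ * ∑ i ∈ S, ∑ j ∈ S'ᶜ, a i j) =
        ∑ i ∈ S, ∑ j ∈ S'ᶜ, a i j := by field_simp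
    have e2 : κ / (2 * η) * (η * ∑ i ∈ S, ∑ j, a i j) = κ / 2 * ∑ i ∈ S, ∑ j, a i j := by
      field_simp
    rwa [e1, e2] at h
  linarith

/-- An almost superharmonic function on an expander is, on more than half of the vertices, at most
slightly above its value at any given `i₀`: the volume of the sublevel sets, starting from the level
`w i₀`, grows geometrically for as long as they hold at most half of the vertices, so `T` steps
exhaust the available volume `card V * d'`. -/
lemma card_sublevel_gt_half {a : V → V → ℝ} (hsymm : ∀ i j, a i j = a j i)
    (hnonneg : ∀ i j, 0 ≤ a i j) {U : Finset V} (hU : ∀ i j, j ∉ U → a i j = 0) {κ η : ℝ}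
    (hκ : 0 < κ) (hη : 0 < η)
    (hexp : ∀ S ⊆ U, (S.card : ℝ) ≤ (Fintype.card V : ℝ) / 2 →
      κ * ∑ i ∈ S, ∑ j, a i j ≤ ∑ i ∈ S, ∑ j ∈ Sᶜ, a i j)
    {d d' : ℝ} (hd : ∀ i ∈ U, d ≤ ∑ j, a i j) (hd' : ∀ i ∈ U, ∑ j, a i j ≤ d') (hd'0 : 0 ≤ d')
    {T : ℕ} (hT : Fintype.card V * d' < (1 + κ / 2) ^ T * d) {w : V → ℝ}
    (hw : ∀ i ∈ U, -η * ∑ j, a i j ≤ ∑ j, a i j * (w i - w j)) {i₀ : V} (hi₀ : i₀ ∈ U) :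
    (Fintype.card V : ℝ) / 2 < (U.filter (w · ≤ w i₀ + T * (2 * η / κ))).card := by
  by_contra! hcon
  have hgap : 0 < 2 * η / κ := by positivity
  have hgrow : ∀ m ≤ T, (1 + κ / 2) ^ m * d ≤
      ∑ i ∈ U with w i ≤ w i₀ + m * (2 * η / κ), ∑ j, a i j := by
    intro m
    induction m with
    | zero =>
      intro _
      simp only [pow_zero, one_mul, Nat.cast_zero, zero_mul, add_zero]
      refine (hd i₀ hi₀).trans ?_
      exact Finset.single_le_sum (f := fun i => ∑ j, a i j)
        (fun i _ => Finset.sum_nonneg fun j _ => hnonneg i j) (by simp [hi₀])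
    | succ m ih =>
      intro hm
      have hsub : U.filter (w · ≤ w i₀ + m * (2 * η / κ)) ⊆
          U.filter (w · ≤ w i₀ + T * (2 * η / κ)) := by
        intro i hi
        simp only [Finset.mem_filter] at hi ⊢
        have : (m : ℝ) * (2 * η / κ) ≤ T * (2 * η / κ) := by
          have : (m : ℝ) ≤ T := by exact_mod_cast (by omega : m ≤ T)
          gcongr
        exact ⟨hi.1, by linarith⟩
      have hcard : ((U.filter (w · ≤ w i₀ + m * (2 * η / κ))).card : ℝ) ≤
          (Fintype.card V : ℝ) / 2 :=
        le_trans (by exact_mod_cast Finset.card_le_card hsub) hcon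
      have h := sublevel_volume_growth hsymm hnonneg hU hκ hη hw (w i₀ + m * (2 * η / κ))
        (hexp _ (Finset.filter_subset _ _) hcard)
      have e : w i₀ + m * (2 * η / κ) + 2 * η / κ = w i₀ + (m + 1 : ℕ) * (2 * η / κ) := by
        push_cast; ring
      rw [e] at h
      refine le_trans ?_ h
      rw [pow_succ', mul_assoc]
      exact mul_le_mul_of_nonneg_left (ih (by omega)) (by positivity)
  have h1 := hgrow T le_rfl
  have h2 : ∑ i ∈ U with w i ≤ w i₀ + T * (2 * η / κ), ∑ j, a i j ≤ Fintype.card V * d' := by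
    refine (Finset.sum_le_card_nsmul _ _ d' fun i hi => hd' i (Finset.mem_filter.1 hi).1).trans ?_
    rw [nsmul_eq_mul]
    exact mul_le_mul_of_nonneg_right (by exact_mod_cast Finset.card_le_univ _) hd'0
  linarith

/-- If a small nonnegative barrier `g` makes both `g + v` and `g - v` almost superharmonic, then `v`
is nearly constant. The first function shows that `v` is close to `v j` or below on more than half
of the vertices, the second that it is close to `v i` or above on more than half; these two sets
meet. -/
lemma oscillation_le_of_barrier {a : V → V → ℝ} (hsymm : ∀ i j, a i j = a j i)
    (hnonneg : ∀ i j, 0 ≤ a i j) {U : Finset V} (hU : ∀ i j, j ∉ U → a i j = 0) {κ η : ℝ}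
    (hκ : 0 < κ) (hη : 0 < η)
    (hexp : ∀ S ⊆ U, (S.card : ℝ) ≤ (Fintype.card V : ℝ) / 2 →
      κ * ∑ i ∈ S, ∑ j, a i j ≤ ∑ i ∈ S, ∑ j ∈ Sᶜ, a i j)
    {d d' : ℝ} (hd : ∀ i ∈ U, d ≤ ∑ j, a i j) (hd' : ∀ i ∈ U, ∑ j, a i j ≤ d') (hd'0 : 0 ≤ d')
    {T : ℕ} (hT : Fintype.card V * d' < (1 + κ / 2) ^ T * d) {g v : V → ℝ} {ψ : ℝ}
    (hg0 : ∀ i, 0 ≤ g i) (hgψ : ∀ i, g i ≤ ψ)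
    (hgv : ∀ i ∈ U, |∑ j, a i j * (v i - v j)| ≤
      ∑ j, a i j * (g i - g j) + η * ∑ j, a i j) {i j : V} (hi : i ∈ U) (hj : j ∈ U) :
    v i - v j ≤ 2 * ψ + 2 * (T * (2 * η / κ)) := by
  have hplus := card_sublevel_gt_half (w := fun i => g i + v i) hsymm hnonneg hU hκ hη hexp hd hd'
    hd'0 hT (fun i hi => by
      have e : ∑ j, a i j * ((g i + v i) - (g j + v j)) =
          ∑ j, a i j * (g i - g j) + ∑ j, a i j * (v i - v j) := by
        rw [← Finset.sum_add_distrib]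
        exact Finset.sum_congr rfl fun j _ => by ring
      have := (abs_le.1 (hgv i hi)).1
      rw [e]; linarith) hj
  have hminus := card_sublevel_gt_half (w := fun i => g i - v i) hsymm hnonneg hU hκ hη hexp hd hd'
    hd'0 hT (fun i hi => by
      have e : ∑ j, a i j * ((g i - v i) - (g j - v j)) =
          ∑ j, a i j * (g i - g j) - ∑ j, a i j * (v i - v j) := by
        rw [← Finset.sum_sub_distrib]
        exact Finset.sum_congr rfl fun j _ => by ring
      have := (abs_le.1 (hgv i hi)).2
      rw [e]; linarith) hi
  obtain ⟨z, hz⟩ : (U.filter (fun k => g k + v k ≤ g j + v j + T * (2 * η / κ)) ∩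
      U.filter (fun k => g k - v k ≤ g i - v i + T * (2 * η / κ))).Nonempty := by
    apply Finset.inter_nonempty_of_card_lt_card_add_card (Finset.subset_univ _)
      (Finset.subset_univ _)
    have : (Fintype.card V : ℝ) < (U.filter (fun k => g k + v k ≤ g j + v j +
        T * (2 * η / κ))).card + (U.filter (fun k => g k - v k ≤ g i - v i +
        T * (2 * η / κ))).card := by linarith
    rw [Finset.card_univ]
    exact_mod_cast this
  simp only [Finset.mem_inter, Finset.mem_filter] at hz
  linarith [hz.1.2, hz.2.2, hg0 z, hgψ i, hgψ j]

end WeightedExpansion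

/-! ### Common neighbours and the maximum principle -/

section Graph

variable {V : Type*}

lemma fourCycle_isCycle {G : SimpleGraph V} {i x y z : V} (hiy : G.Adj i y) (hyx : G.Adj y x)
    (hxz : G.Adj x z) (hzi : G.Adj z i) (hix : i ≠ x) (hyz : y ≠ z) :
    (SimpleGraph.Walk.cons hiy (.cons hyx (.cons hxz (.cons hzi .nil)))).IsCycle := by
  have := hiy.ne
  have := hyx.ne
  have := hxz.ne
  have := hzi.ne
  rw [SimpleGraph.Walk.cons_isCycle_iff]
  constructor
  · simp [SimpleGraph.Walk.cons_isPath_iff]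
    grind
  · simp
    grind

/-- Three common neighbours of two vertices would give two different `4`-cycles through the same
vertex, which are short cycles at distance `0`. -/
lemma card_common_neighbors_le_two [Fintype V] [DecidableEq V] {G : SimpleGraph V} [DecidableRel G.Adj] {C₁ C₂ δ C : ℝ} {K : ℕ}
    (hG : ElectricalNetwork.IsProper G C₁ C₂ K δ C)
    (hlog : 0 < Real.log (Real.log (Fintype.card V)))
    (hn : 40 * Real.log (Real.log (Fintype.card V)) ≤ Real.log (Fintype.card V))
    {i x : V} (hix : i ≠ x) :
    (Finset.univ.filter fun y => G.Adj i y ∧ G.Adj y x).card ≤ 2 := by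
  by_contra! h
  obtain ⟨y, z, z', hy, hz, hz', hyz, hyz', hzz'⟩ := Finset.two_lt_card_iff.1 h
  simp only [Finset.mem_filter, Finset.mem_univ, true_and] at hy hz hz'
  have hshort : (4 : ℝ) ≤ Real.log (Fintype.card V) /
      (10 * Real.log (Real.log (Fintype.card V))) := by
    rw [le_div_iff₀ (by positivity)]; linarith
  have hdist := hG.short_cycles_far i i _ _
    (fourCycle_isCycle hy.1 hy.2 hz.2.symm hz.1.symm hix hyz)
    (fourCycle_isCycle hy.1 hy.2 hz'.2.symm hz'.1.symm hix hyz')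
    (by simpa using hshort) (by simpa using hshort)
    (by
      intro he
      have hmem : s(z, i) ∈ {e | e ∈ (SimpleGraph.Walk.cons hy.1 (.cons hy.2
          (.cons hz'.2.symm (.cons hz'.1.symm .nil)))).edges} := by
        rw [← he]; simp
      have := hy.1.ne
      have := hz.1.ne
      have := hz.2.ne
      simp at hmem
      grind) i (by simp) i (by simp)
  rw [SimpleGraph.dist_self, Nat.cast_zero] at hdist
  have : 0 < Real.log (Fintype.card V) / Real.log (Real.log (Fintype.card V)) :=
    div_pos (by linarith) hlog
  linarith

/-- The maximum principle: a potential is bounded above by its boundary values. -/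
lemma le_of_isPotential [Fintype V] {G : SimpleGraph V} [DecidableRel G.Adj] {C₁ C₂ : ℝ}
    (hC₁ : 0 < C₁) (hconn : G.Connected) {c : V → V → ℝ}
    (hc : ElectricalNetwork.IsConductance G C₁ C₂ c) {K : ℕ} (hK : 1 ≤ K) {x : Fin K → V}
    {p : Fin K → ℝ} {v : V → ℝ} (hv : ElectricalNetwork.IsPotential G c x p v) {m : ℝ}
    (hp : ∀ k, p k ≤ m) (i : V) : v i ≤ m := by
  have : Nonempty V := ⟨i⟩
  obtain ⟨z, hz⟩ := Finite.exists_max v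
  by_contra! hi
  have hzm : m < v z := hi.trans_le (hz i)
  have hall : ∀ y, G.Reachable z y → v y = v z := by
    rintro y ⟨q⟩
    induction q using SimpleGraph.Walk.concatRec with
    | Hnil => rfl
    | @Hconcat u a b q hab ih =>
      have ha := ih hz hzm
      have hmem : a ∉ Set.range x := by
        rintro ⟨k, rfl⟩
        have := hp k
        rw [hv.boundary k] at ha
        linarith
      have hsum := hv.kirchhoff a hmem
      rw [Finset.sum_eq_zero_iff_of_nonneg] at hsum
      · have h := hsum b (by simpa using hab)
        have := hc.lower a b hab
        rcases mul_eq_zero.1 h with h | h <;> linarith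
      · intro j hj
        have := hc.lower a j (Finset.mem_filter.1 hj).2
        exact mul_nonneg (by linarith) (by linarith [hz j])
  have h := hall (x ⟨0, hK⟩) (hconn.preconnected _ _)
  rw [hv.boundary] at h
  linarith [hp ⟨0, hK⟩]

lemma ge_of_isPotential [Fintype V] {G : SimpleGraph V} [DecidableRel G.Adj] {C₁ C₂ : ℝ}
    (hC₁ : 0 < C₁) (hconn : G.Connected) {c : V → V → ℝ}
    (hc : ElectricalNetwork.IsConductance G C₁ C₂ c) {K : ℕ} (hK : 1 ≤ K) {x : Fin K → V}
    {p : Fin K → ℝ} {v : V → ℝ} (hv : ElectricalNetwork.IsPotential G c x p v) {m : ℝ}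
    (hp : ∀ k, m ≤ p k) (i : V) : m ≤ v i := by
  have hneg : ElectricalNetwork.IsPotential G c x (-p) (-v) :=
    ⟨fun k => by simp [hv.boundary k], fun i hi => by
      rw [← neg_eq_zero, ← Finset.sum_neg_distrib, ← hv.kirchhoff i hi]
      refine Finset.sum_congr rfl fun j _ => ?_
      simp only [Pi.neg_apply]; ring⟩
  have := le_of_isPotential hC₁ hconn hc hK hneg (m := -m) (fun k => by simpa using hp k) i
  simpa using this

end Graph

/-! ### The network induced on the interior -/

section Network

variable {V : Type*} [Fintype V] [DecidableEq V]

/-- The conductances of the network induced on `V \ L`, as a weight function on all of `V × V` that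
vanishes wherever there is no edge or an end lies in `L`. The vertices of `L` stay in the index set,
isolated, so that no subtype is needed. -/
noncomputable def inducedWeight (G : SimpleGraph V) [DecidableRel G.Adj] (c : V → V → ℝ)
    (L : Finset V) (i j : V) : ℝ :=
  if G.Adj i j ∧ i ∉ L ∧ j ∉ L then c i j else 0

variable {G : SimpleGraph V} [DecidableRel G.Adj] {C₁ C₂ : ℝ} {c : V → V → ℝ}

omit [Fintype V] in
lemma inducedWeight_symm (hc : ElectricalNetwork.IsConductance G C₁ C₂ c) (L : Finset V)
    (i j : V) : inducedWeight G c L i j = inducedWeight G c L j i := by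
  unfold inducedWeight
  by_cases h : G.Adj i j
  · simp [h, h.symm, hc.symm i j h, and_comm]
  · simp [h, show ¬ G.Adj j i from fun h' => h h'.symm]

omit [Fintype V] in
lemma inducedWeight_nonneg (hC₁ : 0 < C₁) (hc : ElectricalNetwork.IsConductance G C₁ C₂ c)
    (L : Finset V) (i j : V) : 0 ≤ inducedWeight G c L i j := by
  unfold inducedWeight
  split_ifs with h
  · exact hC₁.le.trans (hc.lower i j h.1)
  · exact le_rfl

lemma sum_inducedWeight_mul {L : Finset V} {i : V} (hi : i ∉ L) (f : V → ℝ) :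
    ∑ j, inducedWeight G c L i j * f j = ∑ j with G.Adj i j ∧ j ∉ L, c i j * f j := by
  rw [Finset.sum_filter]
  refine Finset.sum_congr rfl fun j _ => ?_
  simp [inducedWeight, hi]

lemma sum_inducedWeight {L : Finset V} {i : V} (hi : i ∉ L) :
    ∑ j, inducedWeight G c L i j = ElectricalNetwork.inducedConductance G c L i := by
  simpa [ElectricalNetwork.inducedConductance] using
    sum_inducedWeight_mul (G := G) (c := c) hi (fun _ => 1)

lemma sum_compl_inducedWeight {L S : Finset V} (hS : Disjoint S L) :
    ∑ i ∈ S, ∑ j ∈ Sᶜ, inducedWeight G c L i j = ElectricalNetwork.cutConductance G c L S := by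
  unfold ElectricalNetwork.cutConductance
  refine Finset.sum_congr rfl fun i hi => ?_
  have hiL := Finset.disjoint_left.1 hS hi
  rw [show Sᶜ = Finset.univ.filter (· ∉ S) by ext; simp, Finset.sum_filter, Finset.sum_filter]
  refine Finset.sum_congr rfl fun j _ => ?_
  by_cases hj : j ∈ S <;> simp [inducedWeight, hiL, hj]

lemma card_boundary_neighbors_le {K : ℕ} {x : Fin K → V} {i : V} :
    (Finset.univ.filter fun j => G.Adj i j ∧ j ∈ Finset.univ.image x).card ≤ K := by
  refine (Finset.card_le_card (t := Finset.univ.image x) fun j hj => ?_).trans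
    (Finset.card_image_le.trans (by simp))
  exact (Finset.mem_filter.1 hj).2.2

lemma degree_le_card_interior_neighbors_add {K : ℕ} (x : Fin K → V) (i : V) :
    G.degree i ≤ (Finset.univ.filter fun j => G.Adj i j ∧ j ∉ Finset.univ.image x).card + K := by
  have h := Finset.card_filter_add_card_filter_not (s := G.neighborFinset i)
    (fun j => j ∉ Finset.univ.image x)
  rw [G.card_neighborFinset_eq_degree] at h
  have h1 : (G.neighborFinset i).filter (fun j => j ∉ Finset.univ.image x) =
      Finset.univ.filter fun j => G.Adj i j ∧ j ∉ Finset.univ.image x := by ext; simp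
  have h2 : (G.neighborFinset i).filter (fun j => ¬ j ∉ Finset.univ.image x) =
      Finset.univ.filter fun j => G.Adj i j ∧ j ∈ Finset.univ.image x := by ext; simp
  rw [h1, h2] at h
  have := card_boundary_neighbors_le (G := G) (x := x) (i := i)
  omega

lemma inducedConductance_lower (hC₁ : 0 < C₁) (hc : ElectricalNetwork.IsConductance G C₁ C₂ c)
    {K : ℕ} (x : Fin K → V) (i : V) :
    C₁ * ((G.degree i : ℝ) - K) ≤
      ElectricalNetwork.inducedConductance G c (Finset.univ.image x) i := by
  have h : (G.degree i : ℝ) ≤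
      (Finset.univ.filter fun j => G.Adj i j ∧ j ∉ Finset.univ.image x).card + K := by
    exact_mod_cast degree_le_card_interior_neighbors_add x i
  have h2 := Finset.card_nsmul_le_sum
    (Finset.univ.filter fun j => G.Adj i j ∧ j ∉ Finset.univ.image x) (c i) C₁
    fun j hj => hc.lower i j (Finset.mem_filter.1 hj).2.1
  rw [nsmul_eq_mul] at h2
  unfold ElectricalNetwork.inducedConductance
  nlinarith

lemma inducedConductance_upper (hC₂ : 0 ≤ C₂) (hc : ElectricalNetwork.IsConductance G C₁ C₂ c)
    (L : Finset V) (i : V) :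
    ElectricalNetwork.inducedConductance G c L i ≤ C₂ * G.degree i := by
  have h2 := Finset.sum_le_card_nsmul
    (Finset.univ.filter fun j => G.Adj i j ∧ j ∉ L) (c i) C₂
    fun j hj => hc.upper i j (Finset.mem_filter.1 hj).2.1
  rw [nsmul_eq_mul] at h2
  unfold ElectricalNetwork.inducedConductance
  have h : (Finset.univ.filter fun j => G.Adj i j ∧ j ∉ L).card ≤ G.degree i := by
    rw [← G.card_neighborFinset_eq_degree]
    exact Finset.card_le_card fun j hj => by simp at hj ⊢; exact hj.1
  have h' : ((Finset.univ.filter fun j => G.Adj i j ∧ j ∉ L).card : ℝ) ≤ G.degree i := by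
    exact_mod_cast h
  nlinarith

/-- Kirchhoff's law at an interior vertex: the Laplacian of the potential in the network induced on the
interior is the current received from the boundary vertices. -/
lemma interior_current_eq_neg_boundary_current {K : ℕ} {x : Fin K → V} {p : Fin K → ℝ} {v : V → ℝ}
    (hv : ElectricalNetwork.IsPotential G c x p v) {i : V} (hi : i ∉ Set.range x) :
    ∑ j with G.Adj i j ∧ j ∉ Finset.univ.image x, c i j * (v i - v j) =
      -∑ j with G.Adj i j ∧ j ∈ Finset.univ.image x, c i j * (v i - v j) := by
  have h := hv.kirchhoff i hi
  rw [← Finset.sum_filter_add_sum_filter_not _ (fun j => j ∉ Finset.univ.image x),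
    Finset.filter_filter, Finset.filter_filter] at h
  simp only [not_not] at h
  linarith

lemma abs_boundary_current_le (hC₁ : 0 < C₁) (hC₁₂ : C₁ ≤ C₂)
    (hc : ElectricalNetwork.IsConductance G C₁ C₂ c)
    {K : ℕ} {x : Fin K → V} {v : V → ℝ} (hv0 : ∀ i, 0 ≤ v i) (hv1 : ∀ i, v i ≤ 1) (i : V) :
    |∑ j with G.Adj i j ∧ j ∈ Finset.univ.image x, c i j * (v i - v j)| ≤ K * C₂ := by
  refine (Finset.abs_sum_le_sum_abs _ _).trans ?_
  refine (Finset.sum_le_card_nsmul _ _ C₂ fun j hj => ?_).trans ?_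
  · have hij := (Finset.mem_filter.1 hj).2.1
    have h1 : |v i - v j| ≤ 1 := abs_le.2 ⟨by linarith [hv0 i, hv1 j], by linarith [hv0 j, hv1 i]⟩
    have h2 := hc.lower i j hij
    rw [abs_mul, abs_of_nonneg (by linarith)]
    nlinarith [hc.upper i j hij, abs_nonneg (v i - v j)]
  · rw [nsmul_eq_mul]
    exact mul_le_mul_of_nonneg_right (by exact_mod_cast card_boundary_neighbors_le) (by linarith)

/-- A vertex off the boundary has at most `2K` neighbours that are adjacent to the boundary, as it has
at most two common neighbours with each boundary vertex. -/
lemma card_near_le {K : ℕ} {x : Fin K → V}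
    (hcommon : ∀ i y, i ≠ y → (Finset.univ.filter fun j => G.Adj i j ∧ G.Adj j y).card ≤ 2)
    {i : V} (hi : i ∉ Set.range x) :
    (Finset.univ.filter fun j => G.Adj i j ∧ ∃ k, G.Adj j (x k)).card ≤ 2 * K := by
  have hsub : (Finset.univ.filter fun j => G.Adj i j ∧ ∃ k, G.Adj j (x k)) ⊆
      Finset.univ.biUnion fun k => Finset.univ.filter fun j => G.Adj i j ∧ G.Adj j (x k) := by
    intro j hj
    simp only [Finset.mem_filter, Finset.mem_biUnion, Finset.mem_univ, true_and] at hj ⊢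
    obtain ⟨h, k, hk⟩ := hj
    exact ⟨k, h, hk⟩
  refine (Finset.card_le_card hsub).trans ((Finset.card_biUnion_le_card_mul _ _ 2 fun k _ =>
    hcommon i (x k) fun h => hi ⟨k, h.symm⟩).trans ?_)
  simp [mul_comm]

/-! ### The barrier and the oscillation of the potential -/

/-- The barrier equal to `ψ` on the neighbours of the boundary and to `0` elsewhere. At a neighbour of
the boundary, at least half of the edges leave the support of the barrier, and `ψ` is chosen so that
the barrier's Laplacian absorbs the current `≤ K * C₂` received from the boundary. Elsewhere the
potential is harmonic for the induced network, and the barrier's Laplacian is at least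
`-2 * K * C₂ * ψ` because only `2K` neighbours lie in the support; this is absorbed by `η`. -/
lemma abs_laplacian_le_laplacian_barrier (hC₁ : 0 < C₁) (hC₁₂ : C₁ ≤ C₂)
    (hc : ElectricalNetwork.IsConductance G C₁ C₂ c) {K : ℕ}
    {x : Fin K → V} {p : Fin K → ℝ} {v : V → ℝ}
    (hv : ElectricalNetwork.IsPotential G c x p v) (hv0 : ∀ i, 0 ≤ v i) (hv1 : ∀ i, v i ≤ 1)
    (hcommon : ∀ i y, i ≠ y → (Finset.univ.filter fun j => G.Adj i j ∧ G.Adj j y).card ≤ 2)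
    {D : ℝ} (hD0 : 0 < D) (hD : ∀ i, D ≤ G.degree i) (hDK : 6 * K ≤ D) {ψ η : ℝ}
    (hψ : ψ = 2 * K * C₂ / (C₁ * D)) (hη : η = 4 * K * C₂ * ψ / (C₁ * D))
    {i : V} (hi : i ∉ Finset.univ.image x) :
    |∑ j, inducedWeight G c (Finset.univ.image x) i j * (v i - v j)| ≤
      ∑ j, inducedWeight G c (Finset.univ.image x) i j *
        ((if ∃ k, G.Adj i (x k) then ψ else 0) - (if ∃ k, G.Adj j (x k) then ψ else 0)) +
      η * ∑ j, inducedWeight G c (Finset.univ.image x) i j := by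
  have hC₂ : 0 < C₂ := by linarith
  have hψ0 : 0 ≤ ψ := by rw [hψ]; positivity
  have hη0 : 0 ≤ η := by rw [hη]; positivity
  have hi' : i ∉ Set.range x := by simpa using hi
  have hnear : ((Finset.univ.filter fun j => G.Adj i j ∧ ∃ k, G.Adj j (x k)).card : ℝ) ≤ 2 * K := by
    exact_mod_cast card_near_le hcommon hi'
  have hvol : C₁ * (D / 2) ≤ ElectricalNetwork.inducedConductance G c (Finset.univ.image x) i := by
    refine le_trans ?_ (inducedConductance_lower hC₁ hc x i)
    exact mul_le_mul_of_nonneg_left (by linarith [hD i]) hC₁.le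
  have hwpos := inducedWeight_nonneg hC₁ hc (Finset.univ.image x) i
  rw [sum_inducedWeight hi, sum_inducedWeight_mul hi (fun j => v i - v j),
    interior_current_eq_neg_boundary_current hv hi', abs_neg]
  by_cases hnb : ∃ k, G.Adj i (x k)
  · have h1 := abs_boundary_current_le hC₁ hC₁₂ hc (x := x) hv0 hv1 i
    have hcard : D / 2 ≤ ((Finset.univ.filter fun j => (G.Adj i j ∧ j ∉ Finset.univ.image x) ∧
        ¬ ∃ k, G.Adj j (x k)).card : ℝ) := by
      have e := Finset.card_filter_add_card_filter_not
        (s := Finset.univ.filter fun j => G.Adj i j ∧ j ∉ Finset.univ.image x)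
        (fun j => ∃ k, G.Adj j (x k))
      rw [Finset.filter_filter, Finset.filter_filter] at e
      have e1 := degree_le_card_interior_neighbors_add (G := G) x i
      have e2 : (Finset.univ.filter fun j => (G.Adj i j ∧ j ∉ Finset.univ.image x) ∧
          ∃ k, G.Adj j (x k)).card ≤ 2 * K :=
        (Finset.card_le_card fun j hj => by
          simp only [Finset.mem_filter] at hj ⊢
          exact ⟨hj.1, hj.2.1.1, hj.2.2⟩).trans (card_near_le hcommon hi')
      have e3 : G.degree i ≤ (Finset.univ.filter fun j =>
          (G.Adj i j ∧ j ∉ Finset.univ.image x) ∧ ¬ ∃ k, G.Adj j (x k)).card + 3 * K := by omega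
      have e4 : (G.degree i : ℝ) ≤ (Finset.univ.filter fun j =>
          (G.Adj i j ∧ j ∉ Finset.univ.image x) ∧ ¬ ∃ k, G.Adj j (x k)).card + 3 * K := by
        exact_mod_cast e3
      linarith [hD i]
    have h2 : (D / 2) * (C₁ * ψ) ≤ ∑ j, inducedWeight G c (Finset.univ.image x) i j *
        ((if ∃ k, G.Adj i (x k) then ψ else 0) - (if ∃ k, G.Adj j (x k) then ψ else 0)) := by
      rw [sum_inducedWeight_mul hi (fun j =>
        ((if ∃ k, G.Adj i (x k) then ψ else 0) - (if ∃ k, G.Adj j (x k) then ψ else 0)))]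
      calc (D / 2) * (C₁ * ψ) ≤ ((Finset.univ.filter fun j =>
            (G.Adj i j ∧ j ∉ Finset.univ.image x) ∧ ¬ ∃ k, G.Adj j (x k)).card : ℝ) *
              (C₁ * ψ) := mul_le_mul_of_nonneg_right hcard (by positivity)
        _ ≤ ∑ j with (G.Adj i j ∧ j ∉ Finset.univ.image x) ∧ ¬ ∃ k, G.Adj j (x k),
            c i j * ψ := by
          rw [← nsmul_eq_mul]
          refine Finset.card_nsmul_le_sum _ _ _ fun j hj => ?_
          exact mul_le_mul_of_nonneg_right (hc.lower i j (Finset.mem_filter.1 hj).2.1.1) hψ0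
        _ = _ := by
          rw [← Finset.filter_filter, Finset.sum_filter]
          refine Finset.sum_congr rfl fun j _ => ?_
          by_cases h : ∃ k, G.Adj j (x k) <;> simp only [hnb, h] <;> simp
    have h3 : (D / 2) * (C₁ * ψ) = K * C₂ := by rw [hψ]; field_simp
    have h4 : 0 ≤ η * ElectricalNetwork.inducedConductance G c (Finset.univ.image x) i :=
      mul_nonneg hη0 (le_trans (by positivity) hvol)
    linarith
  · have h1 : ∑ j with G.Adj i j ∧ j ∈ Finset.univ.image x, c i j * (v i - v j) = 0 := by
      refine Finset.sum_eq_zero fun j hj => ?_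
      obtain ⟨hij, hj⟩ := (Finset.mem_filter.1 hj).2
      obtain ⟨k, -, rfl⟩ := Finset.mem_image.1 hj
      exact absurd ⟨k, hij⟩ hnb
    have h2 : -(2 * K * (C₂ * ψ)) ≤ ∑ j, inducedWeight G c (Finset.univ.image x) i j *
        ((if ∃ k, G.Adj i (x k) then ψ else 0) - (if ∃ k, G.Adj j (x k) then ψ else 0)) := by
      calc -(2 * K * (C₂ * ψ)) ≤
          -∑ j with G.Adj i j ∧ ∃ k, G.Adj j (x k), C₂ * ψ := by
            rw [Finset.sum_const, nsmul_eq_mul]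
            exact neg_le_neg (mul_le_mul_of_nonneg_right hnear (by positivity))
        _ ≤ _ := by
          rw [Finset.sum_filter, ← Finset.sum_neg_distrib]
          refine Finset.sum_le_sum fun j _ => ?_
          simp only [hnb, inducedWeight]
          have := mul_nonneg hC₂.le hψ0
          by_cases h : ∃ k, G.Adj j (x k) <;> by_cases hij : G.Adj i j <;>
            simp only [h, hij, true_and, false_and, and_true, and_false, if_true, if_false] <;>
            try simp
          have := mul_le_mul_of_nonneg_right (hc.upper i j hij) hψ0
          split_ifs <;> simp <;> linarith
    have h3 : η * (C₁ * (D / 2)) = 2 * K * (C₂ * ψ) := by rw [hη]; field_simp; ring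
    have h4 := mul_le_mul_of_nonneg_left hvol hη0
    rw [h1, abs_zero]
    linarith

lemma oscillation_le {δ C : ℝ} {K : ℕ} (hC₁ : 0 < C₁) (hC₁₂ : C₁ ≤ C₂) (hK : 1 ≤ K)
    (hG : ElectricalNetwork.IsProper G C₁ C₂ K δ C)
    (hc : ElectricalNetwork.IsConductance G C₁ C₂ c)
    {x : Fin K → V} {p : Fin K → ℝ} {v : V → ℝ}
    (hv : ElectricalNetwork.IsPotential G c x p v) (hv0 : ∀ i, 0 ≤ v i) (hv1 : ∀ i, v i ≤ 1)
    (hcommon : ∀ i y, i ≠ y → (Finset.univ.filter fun j => G.Adj i j ∧ G.Adj j y).card ≤ 2)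
    {D D' : ℝ} (hD0 : 0 < D) (hD : ∀ i, D ≤ G.degree i) (hD' : ∀ i, G.degree i ≤ D')
    (hDK : 6 * K ≤ D) {T : ℕ}
    (hT : Fintype.card V * (C₂ * D') < (1 + C₁ / (6 * C₂) / 2) ^ T * (C₁ * (D / 2)))
    {i j : V} (hi : i ∉ Set.range x) (hj : j ∉ Set.range x) :
    v i - v j ≤ 4 * K * C₂ / (C₁ * D) + 192 * K ^ 2 * C₂ ^ 3 * T / (C₁ ^ 3 * D ^ 2) := by
  have hC₂ : 0 < C₂ := by linarith
  have hK0 : (0 : ℝ) < K := by exact_mod_cast hK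
  have hL : (Finset.univ.image x).card ≤ K := Finset.card_image_le.trans (by simp)
  set ψ := 2 * K * C₂ / (C₁ * D) with hψ
  have hψ0 : 0 < ψ := by positivity
  set η := 4 * K * C₂ * ψ / (C₁ * D) with hη
  have hη0 : 0 < η := by positivity
  have hmem : ∀ i, i ∈ (Finset.univ.image x)ᶜ ↔ i ∉ Finset.univ.image x := fun i =>
    Finset.mem_compl
  have hD'0 : 0 ≤ D' := (hD0.le.trans (hD i)).trans (hD' i)
  have h := oscillation_le_of_barrier (a := inducedWeight G c (Finset.univ.image x))
    (inducedWeight_symm hc _) (inducedWeight_nonneg hC₁ hc _) (U := (Finset.univ.image x)ᶜ)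
    (fun i j hj => if_neg fun h => hj ((hmem j).2 h.2.2)) (κ := C₁ / (6 * C₂))
    (by positivity) hη0
    (fun S hS hcard => by
      have hdisj : Disjoint S (Finset.univ.image x) :=
        Finset.disjoint_left.2 fun i hi => (hmem i).1 (hS hi)
      rw [sum_compl_inducedWeight hdisj, Finset.sum_congr rfl fun i hi =>
        sum_inducedWeight (Finset.disjoint_left.1 hdisj hi)]
      exact hG.expansion c hc _ S hL hdisj hcard)
    (d := C₁ * (D / 2)) (d' := C₂ * D')
    (fun i hi => by
      rw [sum_inducedWeight ((hmem i).1 hi)]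
      exact (mul_le_mul_of_nonneg_left (by linarith [hD i]) hC₁.le).trans
        (inducedConductance_lower hC₁ hc x i))
    (fun i hi => by
      rw [sum_inducedWeight ((hmem i).1 hi)]
      exact (inducedConductance_upper hC₂.le hc _ i).trans
        (mul_le_mul_of_nonneg_left (hD' i) hC₂.le))
    (by positivity) hT (g := fun i => if ∃ k, G.Adj i (x k) then ψ else 0) (v := v) (ψ := ψ)
    (fun i => by split_ifs <;> linarith)
    (fun i => by split_ifs <;> linarith)
    (fun i hi => abs_laplacian_le_laplacian_barrier hC₁ hC₁₂ hc hv hv0 hv1 hcommon hD0 hD hDK hψ hη ((hmem i).1 hi))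
    (i := i) (j := j) (by simpa using hi) (by simpa using hj)
  refine h.trans_eq ?_
  rw [hη, hψ]
  field_simp
  ring

/-! ### Conservation of current at the boundary -/

/-- The total current that leaves the network through its boundary vertices is zero. -/
lemma sum_boundary_current_eq_zero {K : ℕ} {x : Fin K → V} (hx : Function.Injective x)
    (hc : ElectricalNetwork.IsConductance G C₁ C₂ c) {p : Fin K → ℝ} {v : V → ℝ}
    (hv : ElectricalNetwork.IsPotential G c x p v) :
    ∑ k, ∑ j with G.Adj (x k) j, c (x k) j * (v j - p k) = 0 := by
  have hanti : ∑ i, ∑ j with G.Adj i j, c i j * (v j - v i) = 0 := by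
    have h : ∑ i, ∑ j with G.Adj i j, c i j * (v j - v i) =
        -∑ i, ∑ j with G.Adj i j, c i j * (v j - v i) := by
      simp_rw [Finset.sum_filter]
      conv_lhs => rw [Finset.sum_comm]
      rw [← Finset.sum_neg_distrib]
      refine Finset.sum_congr rfl fun i _ => ?_
      rw [← Finset.sum_neg_distrib]
      refine Finset.sum_congr rfl fun j _ => ?_
      by_cases h : G.Adj i j
      · simp only [h, h.symm, if_true, hc.symm i j h]; ring
      · simp [h, show ¬ G.Adj j i from fun h' => h h'.symm]
    linarith
  rw [← hanti, ← Finset.sum_subset (Finset.subset_univ (Finset.univ.image x)),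
    Finset.sum_image fun a _ b _ h => hx h]
  · simp_rw [hv.boundary]
  · intro i _ hi
    rw [← neg_eq_zero, ← Finset.sum_neg_distrib, ← hv.kirchhoff i (by simpa using hi)]
    exact Finset.sum_congr rfl fun j _ => by ring

/-- If the potential varies by at most `ω` on the interior, conservation of the total current pins it
to the mean of the boundary values weighted by the conductances. The edges inside the boundary,
at most `K` at each boundary vertex, contribute the second error term. -/
lemma abs_sub_weighted_mean_le {K : ℕ} {x : Fin K → V} (hx : Function.Injective x)
    (hC₁ : 0 < C₁) (hC₁₂ : C₁ ≤ C₂) (hK : 1 ≤ K)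
    (hc : ElectricalNetwork.IsConductance G C₁ C₂ c) {p : Fin K → ℝ} {v : V → ℝ}
    (hv : ElectricalNetwork.IsPotential G c x p v) (hv0 : ∀ i, 0 ≤ v i) (hv1 : ∀ i, v i ≤ 1)
    {D : ℝ} (hD0 : 0 < D) (hD : ∀ i, D ≤ G.degree i) {i : V} {ω : ℝ} (hω : 0 ≤ ω)
    (hosc : ∀ j, j ∉ Set.range x → |v i - v j| ≤ ω) :
    |v i - (∑ k, p k * ElectricalNetwork.vertexConductance G c (x k)) /
        (∑ k, ElectricalNetwork.vertexConductance G c (x k))| ≤ ω + K * C₂ / (C₁ * D) := by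
  have hC₂ : 0 < C₂ := by linarith
  have hvc : ∀ y, C₁ * D ≤ ElectricalNetwork.vertexConductance G c y := by
    intro y
    have h := Finset.card_nsmul_le_sum (Finset.univ.filter fun j => G.Adj y j) (c y) C₁
      fun j hj => hc.lower y j (Finset.mem_filter.1 hj).2
    have e : (Finset.univ.filter fun j => G.Adj y j).card = G.degree y := by
      rw [← G.card_neighborFinset_eq_degree]; congr 1; ext; simp
    rw [nsmul_eq_mul, e] at h
    refine le_trans ?_ h
    rw [mul_comm]
    exact mul_le_mul_of_nonneg_right (hD y) hC₁.le
  set W := ∑ k, ElectricalNetwork.vertexConductance G c (x k) with hW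
  have hWlow : K * (C₁ * D) ≤ W := by
    have h := Finset.card_nsmul_le_sum (Finset.univ : Finset (Fin K))
      (fun k => ElectricalNetwork.vertexConductance G c (x k)) (C₁ * D) fun k _ => hvc (x k)
    simpa using h
  have hK0 : (0 : ℝ) < K := by exact_mod_cast hK
  have hW0 : 0 < W := lt_of_lt_of_le (by positivity) hWlow
  have hnum : v i * W - ∑ k, p k * ElectricalNetwork.vertexConductance G c (x k) =
      ∑ k, ∑ j with G.Adj (x k) j, c (x k) j * (v i - v j) := by
    have h0 := sum_boundary_current_eq_zero hx hc hv
    rw [hW, Finset.mul_sum, ← Finset.sum_sub_distrib, ← add_zero (∑ k, ∑ j with _, _), ← h0,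
      ← Finset.sum_add_distrib]
    refine Finset.sum_congr rfl fun k _ => ?_
    rw [ElectricalNetwork.vertexConductance, Finset.mul_sum, Finset.mul_sum,
      ← Finset.sum_sub_distrib, ← Finset.sum_add_distrib]
    exact Finset.sum_congr rfl fun j _ => by ring
  have hk : ∀ k, |∑ j with G.Adj (x k) j, c (x k) j * (v i - v j)| ≤
      ω * ElectricalNetwork.vertexConductance G c (x k) + K * C₂ := by
    intro k
    refine (Finset.abs_sum_le_sum_abs _ _).trans ?_
    calc ∑ j with G.Adj (x k) j, |c (x k) j * (v i - v j)|
        ≤ ∑ j with G.Adj (x k) j, (ω * c (x k) j + if j ∈ Finset.univ.image x then C₂ else 0) := by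
          refine Finset.sum_le_sum fun j hj => ?_
          have hadj := (Finset.mem_filter.1 hj).2
          have hlow := hc.lower _ _ hadj
          have hup := hc.upper _ _ hadj
          rw [abs_mul, abs_of_nonneg (by linarith)]
          split_ifs with hjx
          · have : |v i - v j| ≤ 1 :=
              abs_le.2 ⟨by linarith [hv0 i, hv1 j], by linarith [hv0 j, hv1 i]⟩
            nlinarith [abs_nonneg (v i - v j), mul_nonneg hω (hC₁.le.trans hlow)]
          · have := hosc j (by simpa using hjx)
            nlinarith
      _ ≤ _ := by
          rw [Finset.sum_add_distrib, ← Finset.mul_sum, ← Finset.sum_filter, Finset.filter_filter,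
            Finset.sum_const, nsmul_eq_mul]
          refine add_le_add le_rfl (mul_le_mul_of_nonneg_right ?_ hC₂.le)
          exact_mod_cast card_boundary_neighbors_le
  have htotal : |v i * W - ∑ k, p k * ElectricalNetwork.vertexConductance G c (x k)| ≤
      ω * W + K * (K * C₂) := by
    rw [hnum]
    refine (Finset.abs_sum_le_sum_abs _ _).trans ((Finset.sum_le_sum fun k _ => hk k).trans_eq ?_)
    rw [Finset.sum_add_distrib, ← Finset.mul_sum, hW]
    simp
  have e : v i - (∑ k, p k * ElectricalNetwork.vertexConductance G c (x k)) / W =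
      (v i * W - ∑ k, p k * ElectricalNetwork.vertexConductance G c (x k)) / W := by
    field_simp
  rw [e, abs_div, abs_of_pos hW0, div_le_iff₀ hW0]
  refine htotal.trans ?_
  have h1 : K * (K * C₂) = K * C₂ / (C₁ * D) * (K * (C₁ * D)) := by field_simp
  have h2 := mul_le_mul_of_nonneg_left hWlow (by positivity : 0 ≤ K * C₂ / (C₁ * D))
  linarith

omit [DecidableEq V] in
lemma weighted_mean_mem_Icc (hC₁ : 0 < C₁) (hc : ElectricalNetwork.IsConductance G C₁ C₂ c)
    {K : ℕ} (x : Fin K → V) {p : Fin K → ℝ} (hp : ∀ k, 0 ≤ p k ∧ p k ≤ 1) :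
    (∑ k, p k * ElectricalNetwork.vertexConductance G c (x k)) /
        (∑ k, ElectricalNetwork.vertexConductance G c (x k)) ∈ Set.Icc (0 : ℝ) 1 := by
  have h0 : ∀ y, 0 ≤ ElectricalNetwork.vertexConductance G c y := fun y =>
    Finset.sum_nonneg fun j hj => hC₁.le.trans (hc.lower y j (Finset.mem_filter.1 hj).2)
  constructor
  · exact div_nonneg (Finset.sum_nonneg fun k _ => mul_nonneg (hp k).1 (h0 _))
      (Finset.sum_nonneg fun k _ => h0 _)
  · exact div_le_one_of_le₀ (Finset.sum_le_sum fun k _ => mul_le_of_le_one_left (h0 _) (hp k).2)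
      (Finset.sum_nonneg fun k _ => h0 _)

end Network

/-! ### Choice of constants -/

/-- In the application `l = ln n`: the second inequality makes `4`-cycles short, the third makes the
degrees large compared with the number of boundary vertices. -/
lemma exists_log_threshold (a b : ℝ) :
    ∃ N : ℝ, 1 ≤ N ∧ ∀ l : ℝ, N ≤ l → 0 < Real.log l ∧ 40 * Real.log l ≤ l ∧ a ≤ l ∧ b < l := by
  have h1 : ∀ᶠ l : ℝ in Filter.atTop, 40 * Real.log l ≤ l := by
    filter_upwards [Real.isLittleO_log_id_atTop.def (by norm_num : (0 : ℝ) < 1 / 40),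
      Filter.eventually_ge_atTop 1] with l hl hl1
    rw [id, Real.norm_of_nonneg (Real.log_nonneg hl1), Real.norm_of_nonneg (by linarith)] at hl
    linarith
  obtain ⟨N, hN⟩ := Filter.eventually_atTop.1 (((h1.and (Filter.eventually_gt_atTop 1)).and
    (Filter.eventually_ge_atTop a)).and (Filter.eventually_gt_atTop b))
  refine ⟨max N 1, le_max_right _ _, fun l hl => ?_⟩
  obtain ⟨⟨⟨h1, h2⟩, h3⟩, h4⟩ := hN l ((le_max_left _ _).trans hl)
  exact ⟨Real.log_pos h2, h1, h3, h4⟩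

/-- With `l = ln n`, about `(2 / ln q) * ln n` steps of growth by the factor `q` exceed `r * n`. -/
lemma lt_pow_ceil {q r l : ℝ} (hq : 1 < q) (hr : r < l) :
    r * Real.exp l < q ^ ⌈2 / Real.log q * l⌉₊ := by
  have hlog := Real.log_pos hq
  calc r * Real.exp l < Real.exp l * Real.exp l :=
        mul_lt_mul_of_pos_right (hr.trans (by linarith [Real.add_one_le_exp l])) (Real.exp_pos l)
    _ = Real.exp (Real.log q * (2 / Real.log q * l)) := by
        rw [← Real.exp_add]; congr 1; field_simp; ring
    _ ≤ Real.exp (Real.log q * ⌈2 / Real.log q * l⌉₊) :=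
        Real.exp_le_exp.2 (mul_le_mul_of_nonneg_left (Nat.le_ceil _) hlog.le)
    _ = q ^ ⌈2 / Real.log q * l⌉₊ := by
        rw [mul_comm, Real.exp_nat_mul, Real.exp_log (by linarith)]

theorem theorem3p1 (C₁ C₂ δ C : ℝ) (K : ℕ) (hC₁ : 0 < C₁) (hC₁₂ : C₁ ≤ C₂) (hδ : 0 < δ)
    (hC : 0 < C) (hK : 1 ≤ K) :
    ∃ M : ℝ, 0 < M ∧
      ∀ (V : Type*) [Fintype V] [DecidableEq V] (G : SimpleGraph V) [DecidableRel G.Adj],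
        ElectricalNetwork.IsProper G C₁ C₂ K δ C →
        ∀ c : V → V → ℝ, ElectricalNetwork.IsConductance G C₁ C₂ c →
        ∀ (x : Fin K → V) (p : Fin K → ℝ), Function.Injective x →
          (∀ k, 0 ≤ p k ∧ p k ≤ 1) →
        ∀ v : V → ℝ, ElectricalNetwork.IsPotential G c x p v →
        ∀ i : V, i ∉ Set.range x →
          |v i - (∑ k, p k * ElectricalNetwork.vertexConductance G c (x k)) /
              (∑ k, ElectricalNetwork.vertexConductance G c (x k))|
            ≤ M / Real.log (Fintype.card V) := by
  have hC₂ : 0 < C₂ := by linarith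
  have hK0 : (0 : ℝ) < K := by exact_mod_cast hK
  obtain ⟨N, hN1, hN⟩ := exists_log_threshold (6 * K / (δ * C)) (8 * C₂ / (C₁ * δ))
  have hq : 1 < 1 + C₁ / (6 * C₂) / 2 := by
    have : 0 < C₁ / (6 * C₂) / 2 := by positivity
    linarith
  set A := 2 / Real.log (1 + C₁ / (6 * C₂) / 2) with hA
  have hA0 : 0 < A := div_pos two_pos (Real.log_pos hq)
  set M₁ := 4 * K * C₂ / (C₁ * (δ * C)) +
    192 * K ^ 2 * C₂ ^ 3 * (A + 1) / (C₁ ^ 3 * (δ * C) ^ 2) + K * C₂ / (C₁ * (δ * C)) with hM₁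
  refine ⟨max N M₁, lt_of_lt_of_le (by linarith) (le_max_left _ _), ?_⟩
  intro V _ _ G _ hG c hc x p hx hp v hv i hi
  have hv0 := ge_of_isPotential hC₁ hG.connected hc hK hv (m := 0) fun k => (hp k).1
  have hv1 := le_of_isPotential hC₁ hG.connected hc hK hv (m := 1) fun k => (hp k).2
  have hcard : 1 < Fintype.card V :=
    Fintype.one_lt_card_iff.2 ⟨i, x ⟨0, hK⟩, fun h => hi ⟨_, h.symm⟩⟩
  set l := Real.log (Fintype.card V) with hl
  have hl0 : 0 < l := Real.log_pos (by exact_mod_cast hcard)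
  rcases lt_or_ge l N with hlN | hlN
  -- For bounded `ln n` both the potential and the weighted mean lie in `[0, 1]`, and `N / ln n ≥ 1`.
  · have hmean := weighted_mean_mem_Icc hC₁ hc x hp
    have h1 : 1 ≤ max N M₁ / l := by
      rw [le_div_iff₀ hl0]
      linarith [le_max_left N M₁]
    refine le_trans (abs_le.2 ⟨?_, ?_⟩) h1 <;> linarith [hmean.1, hmean.2, hv0 i, hv1 i]
  · obtain ⟨hl1, hl2, hl3, hl4⟩ := hN l hlN
    have hD0 : 0 < δ * C * l := by positivity
    have hDK : 6 * K ≤ δ * C * l := by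
      rw [div_le_iff₀ (by positivity)] at hl3; linarith
    set T := ⌈A * l⌉₊ with hTdef
    have hT : Fintype.card V * (C₂ * (4 * C * l)) <
        (1 + C₁ / (6 * C₂) / 2) ^ T * (C₁ * (δ * C * l / 2)) := by
      have h := lt_pow_ceil hq hl4
      rw [hl, Real.exp_log (by exact_mod_cast (by omega : 0 < Fintype.card V)), ← hl] at h
      have h' := mul_lt_mul_of_pos_right h (by positivity : 0 < C₁ * (δ * C * l / 2))
      refine lt_of_eq_of_lt ?_ h'
      field_simp
      ring
    have hTle : (T : ℝ) ≤ (A + 1) * l := by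
      have := Nat.ceil_lt_add_one (mul_nonneg hA0.le hl0.le)
      linarith
    have hosc : ∀ i j, i ∉ Set.range x → j ∉ Set.range x → v i - v j ≤
        4 * K * C₂ / (C₁ * (δ * C * l)) +
          192 * K ^ 2 * C₂ ^ 3 * T / (C₁ ^ 3 * (δ * C * l) ^ 2) :=
      fun i j hi hj => oscillation_le hC₁ hC₁₂ hK hG hc hv hv0 hv1
        (fun i y hiy => card_common_neighbors_le_two hG hl1 hl2 hiy) hD0
        (fun i => (hG.degree_lower i).le) (fun i => (hG.degree_upper i).le) hDK hT hi hj
    refine (abs_sub_weighted_mean_le hx hC₁ hC₁₂ hK hc hv hv0 hv1 hD0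
      (fun i => (hG.degree_lower i).le) (by positivity) fun j hj =>
        abs_le.2 ⟨by linarith [hosc j i hj hi], hosc i j hi hj⟩).trans ?_
    -- The number of steps `T` is of order `ln n` while each step costs order `(ln n)⁻²`.
    calc _ ≤ 4 * K * C₂ / (C₁ * (δ * C * l)) +
          192 * K ^ 2 * C₂ ^ 3 * ((A + 1) * l) / (C₁ ^ 3 * (δ * C * l) ^ 2) +
          K * C₂ / (C₁ * (δ * C * l)) := by gcongr
      _ = M₁ / l := by rw [hM₁]; field_simp
      _ ≤ max N M₁ / l := div_le_div_of_nonneg_right (le_max_right _ _) hl0.le
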